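/- Let $I=[-1,1]$. For a real-valued $\psi\in C^1(I)$ and real $\lambda$ put \[ m(\lambda)=m_\psi(\lambda):=\mathrm{p.v.}\int_I e^{i\lambda\psi(t)}\,\frac{dt}{t} =\lim_{\varepsilon\to0^+}\int_{\varepsilon\le|t|\le1}e^{i\lambda\psi(t)}\,\frac{dt}{t}. \] For $s\ge1$, the Gevrey class $G^s(I)$ consists of the functions $\psi\in C^\infty(I)$ for which there is a constant $K>0$ with $\sup_{t\in I}|\psi^{(n)}(t)|\le K^{n+1}(n!)^s$ for all integers $n\ge0$. Let $s>1$. (i) If $\psi\in G^s(I)$ is real-valued, then the limit defining $m(\lambda)$ exists for every $\lambda\in\mathbb R$, and $m(\lambda)=O(\log\log\lambda)$ as $\lambda\to\infty$, with an implicit constant independent of $\lambda$ (it may depend on $\psi$ and $s$). (ii) This bound is sharp: the function \[ \psi(t)=\begin{cases}e^{-t^{-1/(s-1)}},&t>0,\\ 0,&t\le0,\end{cases} \] belongs to $G^s(I)$, and along the sequence $\lambda_n=2\pi n\to\infty$ there are constants $0<c\le C$ with \[ c\,\log\log\lambda_n\le|m(\lambda_n)|\le C\,\log\log\lambda_n\qquad\text{for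 all sufficiently large } n. \] -/

import Mathlib

open scoped ContDiff Nat

noncomputable section

namespace SteinWainger

/-- The Gevrey class `G^s([-1,1])` of real-valued functions: smooth on `[-1,1]` (one-sided
derivatives at the endpoints) with `|ψ⁽ⁿ⁾(t)| ≤ K^(n+1) (n!)^s` on `[-1,1]` for all `n`.
Only the values of `ψ` on `[-1,1]` matter. -/
def Gevrey (s : ℝ) (ψ : ℝ → ℝ) : Prop :=
  ContDiffOn ℝ ∞ ψ (Set.Icc (-1) 1) ∧
    ∃ K : ℝ, 0 < K ∧ ∀ n : ℕ, ∀ t ∈ Set.Icc (-1 : ℝ) 1,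
      |iteratedDerivWithin n ψ (Set.Icc (-1) 1) t| ≤ K ^ (n + 1) * (n ! : ℝ) ^ s

/-- The truncated integral `∫_{ε ≤ |t| ≤ 1} e^{iλψ(t)} dt/t`, for `0 < ε < 1`. -/
def truncated (ψ : ℝ → ℝ) (lam ε : ℝ) : ℂ :=
  (∫ t in (-1 : ℝ)..(-ε), Complex.exp (Complex.I * lam * ψ t) / t) +
    ∫ t in ε..(1 : ℝ), Complex.exp (Complex.I * lam * ψ t) / t

/-- `m(λ) = p.v. ∫_{[-1,1]} e^{iλψ(t)} dt/t`, the limit of the truncated integrals as `ε → 0+`. -/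
def m (ψ : ℝ → ℝ) (lam : ℝ) : ℂ :=
  Filter.limUnder (nhdsWithin (0 : ℝ) (Set.Ioi 0)) (truncated ψ lam)

/-- `ψ(t) = exp(-t^{-1/(s-1)})` for `t > 0`, and `0` for `t ≤ 0`. -/
def flatPhase (s t : ℝ) : ℝ :=
  if 0 < t then Real.exp (-(t ^ (-(1 / (s - 1))))) else 0

end SteinWainger

end

/-!
Folding the integral at the origin writes the truncated integrals as the difference of the one-sided
integrals of `ψ t` and `ψ (-t)` over `[ε, 1]`. On `(0, δ]` the two integrands cancel up to
`|λ| |ψ t - ψ (-t)| / t`, while on `[δ, 1]` either integral is trivially at most `log (1 / δ)`.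

If some derivative of `ψ` of order `k ≥ 1` does not vanish at `0`, take the least such `k` and
`δ = λ ^ (-1 / k)`: the Taylor estimate controls `(0, δ]`, and van der Corput's lemma in the
variable `log t` controls `[δ, 1]`, so `m` is bounded. If all of them vanish, the Taylor estimate of
order about `log λ` and the Gevrey bound allow `δ⁻¹` to be as small as a multiple of `(log λ) ^ s`,
and `log (1 / δ)` is then of size `log log λ`.

For the flat phase the integral over `t < 0` is exactly `-log (1 / ε)`, whereas on `t > 0`
oscillation sets in at `δ = (log λ) ^ (-(s - 1))`; this leaves `log (1 / δ)` uncancelled, up to a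
bounded error. The flat phase is Gevrey by Cauchy's estimates on discs of radius proportional to
`t`.
-/

namespace SteinWainger

open Set Filter Topology MeasureTheory Asymptotics

/-- The one-sided oscillatory integral `∫_α^β e^{iλf(t)} dt/t`. The truncated principal value of `ψ`
is the difference of those of `t ↦ ψ t` and `t ↦ ψ (-t)`. -/
noncomputable def oscInt (f : ℝ → ℝ) (lam α β : ℝ) : ℂ :=
  ∫ t in α..β, Complex.exp (Complex.I * lam * f t) / t

section OscillatoryIntegral

variable {f g : ℝ → ℝ} {α β δ ε : ℝ}

lemma norm_exp_phase (lam x : ℝ) : ‖Complex.exp (Complex.I * lam * x)‖ = 1 := by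
  rw [mul_assoc, ← Complex.ofReal_mul, Complex.norm_exp_I_mul_ofReal]

lemma norm_exp_phase_sub_le (lam x y : ℝ) :
    ‖Complex.exp (Complex.I * lam * x) - Complex.exp (Complex.I * lam * y)‖ ≤
      |lam| * |x - y| := by
  have hfactor : Complex.exp (Complex.I * lam * x) - Complex.exp (Complex.I * lam * y) =
      Complex.exp (Complex.I * lam * y) *
        (Complex.exp (Complex.I * ((lam * (x - y) : ℝ) : ℂ)) - 1) := by
    rw [mul_sub, ← Complex.exp_add]
    push_cast
    ring_nf
  rw [hfactor, norm_mul, norm_exp_phase, one_mul, ← abs_mul]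
  exact Real.norm_exp_I_mul_ofReal_sub_one_le

lemma continuousOn_exp_phase {S : Set ℝ} (hf : ContinuousOn f S) (lam : ℝ) :
    ContinuousOn (fun t : ℝ => Complex.exp (Complex.I * lam * f t)) S := by
  fun_prop

lemma continuousOn_exp_phase_div {S : Set ℝ} (hf : ContinuousOn f S) (hS : (0 : ℝ) ∉ S) (lam : ℝ) :
    ContinuousOn (fun t : ℝ => Complex.exp (Complex.I * lam * f t) / t) S :=
  (continuousOn_exp_phase hf lam).div Complex.continuous_ofReal.continuousOn fun _ ht =>
    Complex.ofReal_ne_zero.2 (ne_of_mem_of_not_mem ht hS)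

lemma intervalIntegrable_exp_phase_div (hf : ContinuousOn f (Icc α β)) (hα : 0 < α) (hαβ : α ≤ β)
    (lam : ℝ) :
    IntervalIntegrable (fun t : ℝ => Complex.exp (Complex.I * lam * f t) / t) volume α β :=
  (continuousOn_exp_phase_div hf (fun h => hα.not_ge h.1) lam).intervalIntegrable_of_Icc hαβ

lemma oscInt_add (hf : ContinuousOn f (Icc ε β)) (hε : 0 < ε) (hεδ : ε ≤ δ) (hδβ : δ ≤ β)
    (lam : ℝ) : oscInt f lam ε δ + oscInt f lam δ β = oscInt f lam ε β :=
  intervalIntegral.integral_add_adjacent_intervals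
    (intervalIntegrable_exp_phase_div (hf.mono (Icc_subset_Icc_right hδβ)) hε hεδ lam)
    (intervalIntegrable_exp_phase_div (hf.mono (Icc_subset_Icc_left hεδ)) (hε.trans_le hεδ) hδβ lam)

lemma norm_oscInt_neg (f : ℝ → ℝ) (lam α β : ℝ) : ‖oscInt (-f) lam α β‖ = ‖oscInt f lam α β‖ := by
  have hconj : oscInt (-f) lam α β = starRingEnd ℂ (oscInt f lam α β) := by
    rw [oscInt, oscInt, ← intervalIntegral.intervalIntegral_conj]
    simp only [map_div₀, ← Complex.exp_conj, map_mul, Complex.conj_I, Complex.conj_ofReal,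
      Pi.neg_apply, Complex.ofReal_neg, neg_mul, mul_neg]
  rw [hconj, RCLike.norm_conj]

lemma norm_oscInt_le_log (f : ℝ → ℝ) (lam : ℝ) (hα : 0 < α) (hαβ : α ≤ β) :
    ‖oscInt f lam α β‖ ≤ Real.log (β / α) := by
  rw [← integral_one_div_of_pos hα (hα.trans_le hαβ)]
  refine intervalIntegral.norm_integral_le_of_norm_le hαβ (ae_of_all _ fun t ht => ?_)
    (intervalIntegral.intervalIntegrable_one_div (fun t ht => ?_) continuousOn_id)
  · rw [norm_div, norm_exp_phase, Complex.norm_real, Real.norm_of_nonneg (hα.trans ht.1).le]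
  · rw [uIcc_of_le hαβ] at ht
    exact (hα.trans_le ht.1).ne'

lemma norm_exp_phase_div_sub_le {D t : ℝ} (lam : ℝ) (ht : 0 < t) (h : |f t - g t| ≤ D * t) :
    ‖Complex.exp (Complex.I * lam * f t) / t - Complex.exp (Complex.I * lam * g t) / t‖ ≤
      |lam| * D := by
  rw [← sub_div, norm_div, Complex.norm_real, Real.norm_of_nonneg ht.le, div_le_iff₀ ht,
    mul_assoc |lam|]
  exact (norm_exp_phase_sub_le _ _ _).trans (mul_le_mul_of_nonneg_left h (abs_nonneg _))

lemma norm_oscInt_sub_le {D : ℝ} (hf : ContinuousOn f (Icc ε δ)) (hg : ContinuousOn g (Icc ε δ))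
    (hε : 0 < ε) (hεδ : ε ≤ δ) (h : ∀ t ∈ Ioc ε δ, |f t - g t| ≤ D * t) (lam : ℝ) :
    ‖oscInt f lam ε δ - oscInt g lam ε δ‖ ≤ |lam| * D * (δ - ε) := by
  rw [oscInt, oscInt, ← intervalIntegral.integral_sub
    (intervalIntegrable_exp_phase_div hf hε hεδ lam)
    (intervalIntegrable_exp_phase_div hg hε hεδ lam), ← abs_of_nonneg (sub_nonneg.2 hεδ)]
  refine intervalIntegral.norm_integral_le_of_norm_le_const fun t ht => ?_
  rw [uIoc_of_le hεδ] at ht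
  exact norm_exp_phase_div_sub_le lam (hε.trans ht.1) (h t ht)

end OscillatoryIntegral

section VanDerCorput

variable {f : ℝ → ℝ} {α β : ℝ}

lemma norm_integral_smul_deriv_le {E : Type*} [NormedAddCommGroup E] [NormedSpace ℝ E]
    [CompleteSpace E] {G G' : ℝ → ℝ} {u u' : ℝ → E} (hαβ : α ≤ β)
    (hG : ∀ t ∈ Icc α β, HasDerivAt G (G' t) t) (hG' : ∀ t ∈ Icc α β, G' t ≤ 0) (hGβ : 0 ≤ G β)
    (hu : ∀ t ∈ Icc α β, HasDerivAt u (u' t) t) (hu' : IntervalIntegrable u' volume α β)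
    (hu1 : ∀ t ∈ Icc α β, ‖u t‖ ≤ 1) : ‖∫ t in α..β, G t • u' t‖ ≤ 2 * G α := by
  have hG'int : IntervalIntegrable (fun t => -G' t) volume α β := by
    refine intervalIntegral.intervalIntegrable_deriv_of_nonneg (g := fun t => -G t) ?_ ?_ ?_ <;>
      simp only [uIcc_of_le hαβ, min_eq_left hαβ, max_eq_right hαβ]
    · exact fun t ht => (hG t ht).continuousAt.continuousWithinAt.neg
    · exact fun t ht => (hG t (Ioo_subset_Icc_self ht)).neg
    · exact fun t ht => neg_nonneg.2 (hG' t (Ioo_subset_Icc_self ht))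
  have hdrop : ∫ t in α..β, -G' t = G α - G β := by
    rw [intervalIntegral.integral_eq_sub_of_hasDerivAt (f := fun t => -G t) _ hG'int]
    · ring
    · rw [uIcc_of_le hαβ]
      exact fun t ht => (hG t ht).neg
  have hrem : ‖∫ t in α..β, G' t • u t‖ ≤ G α - G β := by
    rw [← hdrop]
    refine intervalIntegral.norm_integral_le_of_norm_le hαβ (ae_of_all _ fun t ht => ?_) hG'int
    have ht := Ioc_subset_Icc_self ht
    rw [norm_smul, Real.norm_of_nonpos (hG' t ht)]
    exact mul_le_of_le_one_right (neg_nonneg.2 (hG' t ht)) (hu1 t ht)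
  have hboundary : ∀ t ∈ Icc α β, 0 ≤ G t → ‖G t • u t‖ ≤ G t := fun t ht h => by
    rw [norm_smul, Real.norm_of_nonneg h]
    exact mul_le_of_le_one_right h (hu1 t ht)
  have hGα : 0 ≤ G α := by linarith [norm_nonneg (∫ t in α..β, G' t • u t)]
  have hparts := intervalIntegral.integral_smul_deriv_eq_deriv_smul (u := G) (v := u)
    (by rwa [uIcc_of_le hαβ]) (by rwa [uIcc_of_le hαβ]) (by simpa [Pi.neg_def] using hG'int.neg) hu'
  calc ‖∫ t in α..β, G t • u' t‖
      ≤ ‖G β • u β‖ + ‖G α • u α‖ + ‖∫ t in α..β, G' t • u t‖ := by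
        rw [hparts]
        exact (norm_sub_le _ _).trans (by gcongr; exact norm_sub_le _ _)
    _ ≤ G β + G α + (G α - G β) := by
        gcongr
        · exact hboundary β (right_mem_Icc.2 hαβ) hGβ
        · exact hboundary α (left_mem_Icc.2 hαβ) hGα
    _ = 2 * G α := by ring

-- In the variable `log t` the phase has derivative `h`, and `dt / t` becomes Lebesgue measure.
lemma norm_oscInt_le_of_deriv {h h' : ℝ → ℝ} {lam : ℝ} (hlam : 0 < lam) (hα : 0 < α) (hαβ : α ≤ β)
    (hf : ∀ t ∈ Icc α β, HasDerivAt f (h t / t) t) (hh : ∀ t ∈ Icc α β, HasDerivAt h (h' t) t)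
    (hpos : ∀ t ∈ Icc α β, 0 < h t) (hmono : ∀ t ∈ Icc α β, 0 ≤ h' t) :
    ‖oscInt f lam α β‖ ≤ 2 / (lam * h α) := by
  let u : ℝ → ℂ := fun t => Complex.exp (Complex.I * lam * f t)
  let u' : ℝ → ℂ := fun t => u t * (Complex.I * lam * (h t / t : ℝ))
  have hu : ∀ t ∈ Icc α β, HasDerivAt u (u' t) t := fun t ht =>
    ((hf t ht).ofReal_comp.const_mul (Complex.I * (lam : ℂ))).cexp
  have hu' : IntervalIntegrable u' volume α β := by
    have hu_cont : ContinuousOn u (Icc α β) := HasDerivAt.continuousOn hu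
    have hh_cont : ContinuousOn h (Icc α β) := HasDerivAt.continuousOn hh
    refine ContinuousOn.intervalIntegrable_of_Icc hαβ (hu_cont.mul (continuousOn_const.mul ?_))
    exact Complex.continuous_ofReal.comp_continuousOn
      (hh_cont.div continuousOn_id fun t ht => (hα.trans_le ht.1).ne')
  have hG : ∀ t ∈ Icc α β, HasDerivAt (fun t => (lam * h t)⁻¹)
      (-(lam * h' t) / (lam * h t) ^ 2) t := fun t ht =>
    ((hh t ht).const_mul lam).inv (mul_pos hlam (hpos t ht)).ne'
  have hosc : oscInt f lam α β = -Complex.I * ∫ t in α..β, (lam * h t)⁻¹ • u' t := by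
    rw [oscInt, ← intervalIntegral.integral_const_mul]
    refine intervalIntegral.integral_congr fun t ht => ?_
    rw [uIcc_of_le hαβ] at ht
    have ht0 : (t : ℂ) ≠ 0 := Complex.ofReal_ne_zero.2 (hα.trans_le ht.1).ne'
    have hh0 : (h t : ℂ) ≠ 0 := Complex.ofReal_ne_zero.2 (hpos t ht).ne'
    have hlam0 : (lam : ℂ) ≠ 0 := Complex.ofReal_ne_zero.2 hlam.ne'
    simp only [u', u, Complex.real_smul, Complex.ofReal_inv, Complex.ofReal_mul, Complex.ofReal_div]
    field_simp
    rw [Complex.I_sq, neg_neg]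
  rw [hosc, norm_mul, norm_neg, Complex.norm_I, one_mul, div_eq_mul_inv]
  refine norm_integral_smul_deriv_le hαβ hG (fun t ht => ?_) ?_ hu hu'
    fun t _ => (norm_exp_phase lam (f t)).le
  · exact div_nonpos_of_nonpos_of_nonneg
      (neg_nonpos.2 (mul_nonneg hlam.le (hmono t ht))) (sq_nonneg _)
  · exact inv_nonneg.2 (mul_pos hlam (hpos β (right_mem_Icc.2 hαβ))).le

end VanDerCorput

section PrincipalValue

variable {ψ : ℝ → ℝ} {δ ε : ℝ}

lemma truncated_eq (ψ : ℝ → ℝ) (lam ε : ℝ) :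
    truncated ψ lam ε = oscInt ψ lam ε 1 - oscInt (fun t => ψ (-t)) lam ε 1 := by
  have hreflect := intervalIntegral.integral_comp_neg (a := ε) (b := 1)
    (fun t : ℝ => Complex.exp (Complex.I * lam * ψ t) / t)
  rw [truncated, ← hreflect, oscInt, oscInt, sub_eq_neg_add, ← intervalIntegral.integral_neg]
  simp only [Complex.ofReal_neg, div_neg]

lemma continuousOn_comp_neg (hψ : ContinuousOn ψ (Icc (-1) 1)) :
    ContinuousOn (fun t => ψ (-t)) (Icc (-1) 1) :=
  hψ.comp continuousOn_neg fun _ ht => ⟨neg_le_neg ht.2, neg_le.2 ht.1⟩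

lemma Ioc_zero_one_subset : Ioc (0 : ℝ) 1 ⊆ Icc (-1) 1 :=
  Ioc_subset_Icc_self.trans (Icc_subset_Icc_left (by norm_num))

lemma Icc_one_subset (hε : 0 < ε) : Icc ε 1 ⊆ Icc (-1) 1 :=
  Icc_subset_Icc_left (by linarith)

lemma norm_truncated_le {D : ℝ} (hψ : ContinuousOn ψ (Icc (-1) 1)) (hε : 0 < ε) (hεδ : ε ≤ δ)
    (hδ : δ ≤ 1) (h : ∀ t ∈ Ioc 0 δ, |ψ t - ψ (-t)| ≤ D * t) (lam : ℝ) :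
    ‖truncated ψ lam ε‖ ≤ |lam| * D * (δ - ε) +
      (‖oscInt ψ lam δ 1‖ + ‖oscInt (fun t => ψ (-t)) lam δ 1‖) := by
  have hpos := hψ.mono (Icc_one_subset hε)
  have hneg := (continuousOn_comp_neg hψ).mono (Icc_one_subset hε)
  have hnear : ‖oscInt ψ lam ε δ - oscInt (fun t => ψ (-t)) lam ε δ‖ ≤ |lam| * D * (δ - ε) :=
    norm_oscInt_sub_le (hpos.mono (Icc_subset_Icc_right hδ)) (hneg.mono (Icc_subset_Icc_right hδ))
      hε hεδ (fun t ht => h t ⟨hε.trans ht.1, ht.2⟩) lam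
  rw [truncated_eq, ← oscInt_add hpos hε hεδ hδ, ← oscInt_add hneg hε hεδ hδ, add_sub_add_comm]
  exact (norm_add_le _ _).trans (add_le_add hnear (norm_sub_le _ _))

lemma abs_sub_neg_le_of_lipschitzOnWith {K : NNReal} (hψ : LipschitzOnWith K ψ (Icc (-1) 1))
    {t : ℝ} (ht : t ∈ Ioc 0 1) : |ψ t - ψ (-t)| ≤ K * 2 * t := by
  have h := hψ.dist_le_mul t (Ioc_zero_one_subset ht) (-t)
    ⟨neg_le_neg ht.2, by linarith [ht.1]⟩
  rwa [Real.dist_eq, Real.dist_eq, sub_neg_eq_add, ← two_mul, abs_of_pos (mul_pos two_pos ht.1),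
    ← mul_assoc] at h

lemma tendsto_truncated {K : NNReal} (hψ : LipschitzOnWith K ψ (Icc (-1) 1)) (lam : ℝ) :
    Tendsto (truncated ψ lam) (𝓝[>] 0) (𝓝 (m ψ lam)) := by
  let q : ℝ → ℂ := fun t => Complex.exp (Complex.I * lam * ψ t) / t -
    Complex.exp (Complex.I * lam * ψ (-t)) / t
  have hψ_neg := continuousOn_comp_neg hψ.continuousOn
  have hq_cont : ContinuousOn q (Ioc 0 1) :=
    (continuousOn_exp_phase_div (hψ.continuousOn.mono Ioc_zero_one_subset) (by simp) lam).sub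
      (continuousOn_exp_phase_div (hψ_neg.mono Ioc_zero_one_subset) (by simp) lam)
  have hq_int : IntegrableOn q (uIcc 0 1) := by
    rw [uIcc_of_le zero_le_one, integrableOn_Icc_iff_integrableOn_Ioc]
    refine IntegrableOn.of_bound measure_Ioc_lt_top
      (hq_cont.aestronglyMeasurable measurableSet_Ioc) (|lam| * (K * 2))
      ((ae_restrict_iff' measurableSet_Ioc).2 (ae_of_all _ fun t ht => ?_))
    exact norm_exp_phase_div_sub_le (g := fun t => ψ (-t)) lam ht.1
      (abs_sub_neg_le_of_lipschitzOnWith hψ ht)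
  have hlim : Tendsto (fun ε => ∫ t in ε..1, q t) (𝓝[>] 0) (𝓝 (∫ t in (0 : ℝ)..1, q t)) := by
    have hcont := intervalIntegral.continuousOn_primitive_interval_left hq_int 0 left_mem_uIcc
    rw [uIcc_of_le zero_le_one] at hcont
    rw [← nhdsWithin_Ioc_eq_nhdsGT zero_lt_one]
    exact hcont.mono Ioc_subset_Icc_self
  refine tendsto_nhds_limUnder ⟨_, hlim.congr' ?_⟩
  filter_upwards [Ioc_mem_nhdsGT zero_lt_one] with ε hε
  have hsub := Icc_one_subset hε.1
  rw [truncated_eq, oscInt, oscInt, ← intervalIntegral.integral_sub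
    (intervalIntegrable_exp_phase_div (hψ.continuousOn.mono hsub) hε.1 hε.2 lam)
    (intervalIntegrable_exp_phase_div (hψ_neg.mono hsub) hε.1 hε.2 lam)]

lemma norm_m_le {K : NNReal} {D : ℝ} (hψ : LipschitzOnWith K ψ (Icc (-1) 1)) (hδ : δ ∈ Ioc 0 1)
    (h : ∀ t ∈ Ioc 0 δ, |ψ t - ψ (-t)| ≤ D * t) (lam : ℝ) :
    ‖m ψ lam‖ ≤ |lam| * D * δ +
      (‖oscInt ψ lam δ 1‖ + ‖oscInt (fun t => ψ (-t)) lam δ 1‖) := by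
  have hlim : Tendsto (fun ε => |lam| * D * (δ - ε) +
      (‖oscInt ψ lam δ 1‖ + ‖oscInt (fun t => ψ (-t)) lam δ 1‖)) (𝓝[>] 0) (𝓝 (|lam| * D * (δ - 0) +
      (‖oscInt ψ lam δ 1‖ + ‖oscInt (fun t => ψ (-t)) lam δ 1‖))) :=
    (Continuous.tendsto (by fun_prop) 0).mono_left nhdsWithin_le_nhds
  rw [sub_zero] at hlim
  refine le_of_tendsto_of_tendsto (tendsto_truncated hψ lam).norm hlim ?_
  filter_upwards [Ioc_mem_nhdsGT hδ.1] with ε hε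
  exact norm_truncated_le hψ.continuousOn hε.1 hε.2 hδ.2 h lam

end PrincipalValue

section Taylor

variable {E : Type*} [NormedAddCommGroup E] [NormedSpace ℝ E]

lemma isLittleO_sub_iteratedDeriv {f : ℝ → E} {x : ℝ} {n : ℕ} (hf : ContDiffAt ℝ n f x)
    (h0 : ∀ j < n, iteratedDeriv j f x = 0) :
    (fun t => f t - ((n ! : ℝ)⁻¹ * (t - x) ^ n) • iteratedDeriv n f x) =o[𝓝 x]
      fun t => (t - x) ^ n := by
  obtain ⟨r, hr, hball⟩ := Metric.eventually_nhds_iff_ball.1 (hf.eventually (by simp))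
  have hx : x ∈ Metric.ball x r := Metric.mem_ball_self hr
  have hderiv (j : ℕ) : iteratedDerivWithin j f (Metric.ball x r) x = iteratedDeriv j f x :=
    iteratedDerivWithin_of_isOpen Metric.isOpen_ball hx
  have htaylor := taylor_isLittleO (convex_ball x r) hx fun t ht => (hball t ht).contDiffWithinAt
  rw [Metric.isOpen_ball.nhdsWithin_eq hx] at htaylor
  refine htaylor.congr_left fun t => ?_
  rw [taylor_within_apply, Finset.sum_range_succ, Finset.sum_eq_zero, zero_add, hderiv]
  intro j hj
  rw [hderiv, h0 j (Finset.mem_range.1 hj), smul_zero]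

lemma exists_eventually_mul_pow_le {g : ℝ → ℝ} {n : ℕ} (hg : ContDiffAt ℝ n g 0)
    (h0 : ∀ j < n, iteratedDeriv j g 0 = 0) (hn : 0 < iteratedDeriv n g 0) :
    ∃ c > 0, ∀ᶠ t in 𝓝[>] 0, c * t ^ n ≤ g t := by
  set c := (n ! : ℝ)⁻¹ * iteratedDeriv n g 0
  have hc : 0 < c := by positivity
  refine ⟨c / 2, half_pos hc, ?_⟩
  have hsmall := (isLittleO_sub_iteratedDeriv hg h0).def (half_pos hc)
  filter_upwards [nhdsWithin_le_nhds hsmall, self_mem_nhdsWithin] with t ht (ht0 : 0 < t)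
  rw [sub_zero, smul_eq_mul, mul_right_comm, Real.norm_of_nonneg (pow_pos ht0 n).le] at ht
  linarith [neg_le_of_abs_le ht]

lemma eventually_add_mul_deriv_nonneg {g : ℝ → ℝ} {n : ℕ} (hg : ContDiffAt ℝ ∞ g 0)
    (h0 : ∀ j < n, iteratedDeriv j g 0 = 0) (hn : 0 < iteratedDeriv n g 0) :
    ∀ᶠ t in 𝓝[>] 0, 0 ≤ g t + t * deriv g t := by
  have hg' : ContDiffAt ℝ ∞ (deriv g) 0 := hg.derivWithin le_rfl
  rcases n with _ | k
  · have hcont : ContinuousAt (fun t => g t + t * deriv g t) 0 :=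
      hg.continuousAt.add (continuousAt_id.mul hg'.continuousAt)
    have hpos : ∀ᶠ t in 𝓝 0, 0 < g t + t * deriv g t :=
      hcont.eventually_const_lt (by simpa using hn)
    exact nhdsWithin_le_nhds (hpos.mono fun t ht => ht.le)
  · obtain ⟨c, hc, hcg⟩ := exists_eventually_mul_pow_le (hg.of_le (mod_cast le_top)) h0 hn
    simp only [iteratedDeriv_succ'] at hn
    obtain ⟨c', hc', hcg'⟩ := exists_eventually_mul_pow_le (hg'.of_le (mod_cast le_top))
      (fun j hj => by rw [← iteratedDeriv_succ', h0 _ (by lia)]) hn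
    filter_upwards [hcg, hcg', self_mem_nhdsWithin] with t ht ht' (ht0 : 0 < t)
    have hg_nonneg : 0 ≤ g t := le_trans (by positivity) ht
    have hg'_nonneg : 0 ≤ deriv g t := le_trans (by positivity) ht'
    positivity

lemma abs_sub_le_of_iteratedDeriv_eq_zero {f : ℝ → ℝ} {x t M : ℝ} {n : ℕ}
    (hf : ContDiffOn ℝ (n + 1) f (uIcc x t)) (hx : ContDiffAt ℝ n f x)
    (h0 : ∀ j < n, iteratedDeriv (j + 1) f x = 0)
    (hM : ∀ y ∈ uIoo x t, |iteratedDeriv (n + 1) f y| ≤ M) :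
    |f t - f x| ≤ M * |t - x| ^ (n + 1) := by
  rcases eq_or_ne x t with rfl | hne
  · simp
  obtain ⟨y, hy, htaylor⟩ := taylor_mean_remainder_lagrange_iteratedDeriv hne hf
  have hpoly : taylorWithinEval f n (uIcc x t) x t = f x := by
    rw [taylor_within_apply, Finset.sum_range_succ', Finset.sum_eq_zero, zero_add]
    · simp
    intro j hj
    have hj : j < n := Finset.mem_range.1 hj
    rw [iteratedDerivWithin_eq_iteratedDeriv (uniqueDiffOn_uIcc hne)
      (hx.of_le (mod_cast hj)) left_mem_uIcc, h0 j hj, smul_zero]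
  rw [hpoly] at htaylor
  rw [htaylor, abs_div, abs_mul, abs_pow, Nat.abs_cast]
  have hfac : (1 : ℝ) ≤ (n + 1)! := mod_cast Nat.factorial_pos _
  exact (div_le_self (by positivity) hfac).trans
    (mul_le_mul_of_nonneg_right (hM y hy) (by positivity))

end Taylor

section FiniteType

variable {f : ℝ → ℝ} {n : ℕ}

lemma eventually_hasDerivAt (hf : ContDiffAt ℝ ∞ f 0) :
    ∀ᶠ t in 𝓝[>] 0, HasDerivAt f (deriv f t) t := by
  have hf1 := (hf.of_le (m := 1) (mod_cast le_top)).eventually (by simp)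
  exact nhdsWithin_le_nhds
    (hf1.mono fun t ht => (ht.differentiableAt one_ne_zero).hasDerivAt)

lemma exists_norm_oscInt_le_near_of_pos (hf : ContDiffAt ℝ ∞ f 0)
    (h0 : ∀ j < n, iteratedDeriv (j + 1) f 0 = 0) (hn : 0 < iteratedDeriv (n + 1) f 0) :
    ∃ c > 0, ∃ d ∈ Ioc (0 : ℝ) 1, ∀ lam > 0, ∀ δ ∈ Ioc 0 d,
      ‖oscInt f lam δ d‖ ≤ 2 / (c * (lam * δ ^ (n + 1))) := by
  have hf' : ContDiffAt ℝ ∞ (deriv f) 0 := hf.derivWithin le_rfl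
  simp only [iteratedDeriv_succ'] at h0 hn
  obtain ⟨c, hc, hlower⟩ := exists_eventually_mul_pow_le (hf'.of_le (mod_cast le_top)) h0 hn
  obtain ⟨d, hd : 0 < d, hnear⟩ := mem_nhdsGT_iff_exists_Ioc_subset.1
    ((((eventually_hasDerivAt hf).and (eventually_hasDerivAt hf')).and
      (hlower.and (eventually_add_mul_deriv_nonneg hf' h0 hn))).and (Ioc_mem_nhdsGT one_pos))
  refine ⟨c, hc, d, (hnear ⟨hd, le_rfl⟩).2, fun lam hlam δ hδ => ?_⟩
  have hδ0 := hδ.1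
  have hIcc : ∀ t ∈ Icc δ d, t ∈ Ioc 0 d := fun t ht => ⟨hδ0.trans_le ht.1, ht.2⟩
  have hosc : ‖oscInt f lam δ d‖ ≤ 2 / (lam * (δ * deriv f δ)) := by
    refine norm_oscInt_le_of_deriv (h := fun t => t * deriv f t) hlam hδ0 hδ.2 (fun t ht => ?_)
      (fun t ht => (hasDerivAt_id t).mul (hnear (hIcc t ht)).1.1.2) (fun t ht => ?_)
      fun t ht => ?_
    · rw [mul_div_cancel_left₀ _ (hIcc t ht).1.ne']
      exact (hnear (hIcc t ht)).1.1.1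
    · have ht0 := (hIcc t ht).1
      have hderiv_pos : 0 < deriv f t := (mul_pos hc (pow_pos ht0 n)).trans_le
        (hnear (hIcc t ht)).1.2.1
      positivity
    · simpa using (hnear (hIcc t ht)).1.2.2
  refine hosc.trans (div_le_div_of_nonneg_left zero_le_two (by positivity) ?_)
  calc c * (lam * δ ^ (n + 1)) = lam * (δ * (c * δ ^ n)) := by ring
    _ ≤ lam * (δ * deriv f δ) := by gcongr; exact (hnear hδ).1.2.1

lemma exists_norm_oscInt_le_near (hf : ContDiffAt ℝ ∞ f 0)
    (h0 : ∀ j < n, iteratedDeriv (j + 1) f 0 = 0) (hn : iteratedDeriv (n + 1) f 0 ≠ 0) :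
    ∃ c > 0, ∃ d ∈ Ioc (0 : ℝ) 1, ∀ lam > 0, ∀ δ ∈ Ioc 0 d,
      ‖oscInt f lam δ d‖ ≤ 2 / (c * (lam * δ ^ (n + 1))) := by
  rcases hn.lt_or_gt with hneg | hpos
  · simpa only [norm_oscInt_neg] using exists_norm_oscInt_le_near_of_pos (f := -f) hf.neg (n := n)
      (fun j hj => by rw [iteratedDeriv_neg, h0 j hj, neg_zero])
      (by rwa [iteratedDeriv_neg, neg_pos])
  · exact exists_norm_oscInt_le_near_of_pos hf h0 hpos

lemma exists_norm_oscInt_le (hcont : ContinuousOn f (Ioc 0 1)) (hf : ContDiffAt ℝ ∞ f 0)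
    (h0 : ∀ j < n, iteratedDeriv (j + 1) f 0 = 0) (hn : iteratedDeriv (n + 1) f 0 ≠ 0) :
    ∃ C, ∀ lam > 0, ∀ δ ∈ Ioc 0 1, 1 ≤ lam * δ ^ (n + 1) → ‖oscInt f lam δ 1‖ ≤ C := by
  obtain ⟨c, hc, d, ⟨hd0, hd1⟩, hnear⟩ := exists_norm_oscInt_le_near hf h0 hn
  refine ⟨2 / c + Real.log (1 / d), fun lam hlam δ hδ hlarge => ?_⟩
  rcases le_total d δ with hdδ | hδd
  · have hc_nonneg : 0 ≤ 2 / c := by positivity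
    have hlog : Real.log (1 / δ) ≤ Real.log (1 / d) :=
      Real.log_le_log (one_div_pos.2 hδ.1) (one_div_le_one_div_of_le hd0 hdδ)
    linarith [norm_oscInt_le_log f lam hδ.1 hδ.2]
  · rw [← oscInt_add (hcont.mono fun t ht => ⟨hδ.1.trans_le ht.1, ht.2⟩) hδ.1 hδd hd1]
    refine (norm_add_le _ _).trans
      (add_le_add ((hnear lam hlam δ ⟨hδ.1, hδd⟩).trans ?_) (norm_oscInt_le_log f lam hd0 hd1))
    exact div_le_div_of_nonneg_left zero_le_two hc (le_mul_of_one_le_right hc.le hlarge)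

end FiniteType

section SmoothPhase

variable {ψ : ℝ → ℝ} {n : ℕ}

lemma contDiffAt_zero (hψ : ContDiffOn ℝ ∞ ψ (Icc (-1) 1)) : ContDiffAt ℝ ∞ ψ 0 :=
  hψ.contDiffAt (Icc_mem_nhds (by norm_num) one_pos)

lemma iteratedDerivWithin_Icc_eq_iteratedDeriv {t : ℝ} (hψ : ContDiffOn ℝ ∞ ψ (Icc (-1) 1))
    (ht : t ∈ Ioo (-1) 1) : iteratedDerivWithin n ψ (Icc (-1) 1) t = iteratedDeriv n ψ t :=
  iteratedDerivWithin_eq_iteratedDeriv (uniqueDiffOn_Icc (by norm_num))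
    ((hψ.contDiffAt (Icc_mem_nhds ht.1 ht.2)).of_le (mod_cast le_top)) (Ioo_subset_Icc_self ht)

lemma exists_lipschitzOnWith (hψ : ContDiffOn ℝ ∞ ψ (Icc (-1) 1)) :
    ∃ K, LipschitzOnWith K ψ (Icc (-1) 1) :=
  hψ.exists_lipschitzOnWith (by simp) (convex_Icc _ _) isCompact_Icc

lemma abs_sub_neg_le {M t : ℝ} (hψ : ContDiffOn ℝ ∞ ψ (Icc (-1) 1))
    (h0 : ∀ j < n, iteratedDeriv (j + 1) ψ 0 = 0)
    (hM : ∀ t ∈ Icc (-1) 1, |iteratedDerivWithin (n + 1) ψ (Icc (-1) 1) t| ≤ M)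
    (ht : t ∈ Ioc 0 1) : |ψ t - ψ (-t)| ≤ 2 * M * t ^ (n + 1) := by
  have htaylor : ∀ x ∈ Icc (-1 : ℝ) 1, |ψ x - ψ 0| ≤ M * |x| ^ (n + 1) := fun x hx => by
    have hsub : uIcc 0 x ⊆ Icc (-1) 1 := uIcc_subset_Icc (by norm_num) hx
    have h := abs_sub_le_of_iteratedDeriv_eq_zero ((hψ.of_le (mod_cast le_top)).mono hsub)
      ((contDiffAt_zero hψ).of_le (mod_cast le_top)) h0 (M := M) fun y hy => ?_
    · rwa [sub_zero] at h
    · have hy' : y ∈ Ioo (-1) 1 := ⟨(le_min (by norm_num) hx.1).trans_lt hy.1,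
        hy.2.trans_le (max_le zero_le_one hx.2)⟩
      rw [← iteratedDerivWithin_Icc_eq_iteratedDeriv hψ hy']
      exact hM y (Ioo_subset_Icc_self hy')
  have hpos := htaylor t (Ioc_zero_one_subset ht)
  have hneg := htaylor (-t) ⟨neg_le_neg ht.2, by linarith [ht.1]⟩
  rw [abs_neg] at hneg
  rw [abs_of_pos ht.1] at hpos hneg
  calc |ψ t - ψ (-t)| = |(ψ t - ψ 0) - (ψ (-t) - ψ 0)| := by rw [sub_sub_sub_cancel_right]
    _ ≤ |ψ t - ψ 0| + |ψ (-t) - ψ 0| := abs_sub _ _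
    _ ≤ 2 * M * t ^ (n + 1) := by linarith

lemma norm_m_le_of_iteratedDeriv_eq_zero {M δ : ℝ} (hψ : ContDiffOn ℝ ∞ ψ (Icc (-1) 1))
    (h0 : ∀ j < n, iteratedDeriv (j + 1) ψ 0 = 0)
    (hM : ∀ t ∈ Icc (-1) 1, |iteratedDerivWithin (n + 1) ψ (Icc (-1) 1) t| ≤ M)
    (hδ : δ ∈ Ioc 0 1) (lam : ℝ) :
    ‖m ψ lam‖ ≤ 2 * M * (|lam| * δ ^ (n + 1)) +
      (‖oscInt ψ lam δ 1‖ + ‖oscInt (fun t => ψ (-t)) lam δ 1‖) := by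
  obtain ⟨K, hK⟩ := exists_lipschitzOnWith hψ
  have hM0 : 0 ≤ M := (abs_nonneg _).trans (hM 0 (by norm_num))
  convert norm_m_le (D := 2 * M * δ ^ n) hK hδ (fun t ht => ?_) lam using 2
  · ring
  · have ht0 := ht.1
    refine (abs_sub_neg_le hψ h0 hM ⟨ht.1, ht.2.trans hδ.2⟩).trans ?_
    rw [pow_succ, ← mul_assoc]
    gcongr
    exact ht.2

lemma exists_norm_m_le_of_finite_type (hψ : ContDiffOn ℝ ∞ ψ (Icc (-1) 1))
    (hfin : ∃ n, iteratedDeriv (n + 1) ψ 0 ≠ 0) : ∃ C, ∀ lam ≥ 1, ‖m ψ lam‖ ≤ C := by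
  classical
  obtain ⟨n, hn, h0⟩ : ∃ n, iteratedDeriv (n + 1) ψ 0 ≠ 0 ∧
      ∀ j < n, iteratedDeriv (j + 1) ψ 0 = 0 :=
    ⟨Nat.find hfin, Nat.find_spec hfin, fun j hj => not_not.1 (Nat.find_min hfin hj)⟩
  have hψ0 := contDiffAt_zero hψ
  obtain ⟨Cr, hCr⟩ := exists_norm_oscInt_le (hψ.continuousOn.mono Ioc_zero_one_subset) hψ0 h0 hn
  obtain ⟨Cl, hCl⟩ := exists_norm_oscInt_le (f := fun t => ψ (-t)) (n := n)
    ((continuousOn_comp_neg hψ.continuousOn).mono Ioc_zero_one_subset)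
    (ContDiffAt.comp 0 (by simpa using hψ0) contDiff_neg.contDiffAt)
    (fun j hj => by simp [iteratedDeriv_comp_neg, h0 j hj])
    (by simpa [iteratedDeriv_comp_neg] using hn)
  obtain ⟨M, hM⟩ := isCompact_Icc.exists_bound_of_continuousOn
    (hψ.continuousOn_iteratedDerivWithin (m := n + 1) (mod_cast le_top)
      (uniqueDiffOn_Icc (by norm_num)))
  refine ⟨2 * M + (Cr + Cl), fun lam hlam => ?_⟩
  have hlam0 : 0 < lam := one_pos.trans_le hlam
  set δ := lam ^ (-((n + 1 : ℕ) : ℝ)⁻¹)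
  have hδ : δ ∈ Ioc 0 1 := ⟨by positivity, Real.rpow_le_one_of_one_le_of_nonpos hlam
    (neg_nonpos.2 (by positivity))⟩
  have hpow : lam * δ ^ (n + 1) = 1 := by
    rw [← Real.rpow_natCast, ← Real.rpow_mul hlam0.le, neg_mul, inv_mul_cancel₀ (by positivity),
      Real.rpow_neg_one, mul_inv_cancel₀ hlam0.ne']
  have hm := norm_m_le_of_iteratedDeriv_eq_zero hψ h0 hM hδ lam
  rw [abs_of_pos hlam0, hpow, mul_one] at hm
  linarith [hCr lam hlam0 δ hδ hpow.ge, hCl lam hlam0 δ hδ hpow.ge]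

end SmoothPhase

section FlatPhase

variable {ψ : ℝ → ℝ} {s : ℝ}

lemma Gevrey.mono {s' : ℝ} (hψ : Gevrey s ψ) (hss' : s ≤ s') : Gevrey s' ψ := by
  obtain ⟨hsmooth, K, hK, hbound⟩ := hψ
  refine ⟨hsmooth, K, hK, fun n t ht => (hbound n t ht).trans ?_⟩
  have hfac : (1 : ℝ) ≤ n ! := mod_cast Nat.factorial_pos n
  gcongr

lemma factorial_rpow_le (hs : 0 ≤ s) (n : ℕ) : (n ! : ℝ) ^ s ≤ ((n : ℝ) ^ s) ^ n := by
  rw [← Real.rpow_natCast, ← Real.rpow_mul n.cast_nonneg, mul_comm s,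
    Real.rpow_mul n.cast_nonneg, Real.rpow_natCast]
  gcongr
  exact mod_cast Nat.factorial_le_pow n

-- The radius `δ = (e K (n + 1) ^ s)⁻¹` makes the Taylor remainder of order `n + 1` at most
-- `2 K e ^ (-(n + 1))`, which absorbs `lam`.
lemma norm_m_le_log_of_iteratedDeriv_eq_zero {K lam : ℝ} {n : ℕ}
    (hψ : ContDiffOn ℝ ∞ ψ (Icc (-1) 1)) (hs : 0 ≤ s) (hK : 1 ≤ K)
    (h0 : ∀ j < n, iteratedDeriv (j + 1) ψ 0 = 0)
    (hbound : ∀ t ∈ Icc (-1) 1,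
      |iteratedDerivWithin (n + 1) ψ (Icc (-1) 1) t| ≤ K ^ (n + 2) * ((n + 1)! : ℝ) ^ s)
    (hlam : |lam| ≤ Real.exp 1 ^ (n + 1)) :
    ‖m ψ lam‖ ≤ 2 * K + 2 * (1 + Real.log K + s * Real.log (n + 1 : ℕ)) := by
  have hN1 : (1 : ℝ) ≤ (n + 1 : ℕ) := mod_cast n.succ_pos
  set R := Real.exp 1 * K * ((n + 1 : ℕ) : ℝ) ^ s
  have hR : 1 ≤ R := one_le_mul_of_one_le_of_one_le
    (one_le_mul_of_one_le_of_one_le (Real.one_le_exp zero_le_one) hK) (Real.one_le_rpow hN1 hs)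
  have hR0 : 0 < R := one_pos.trans_le hR
  have hR_inv : R⁻¹ ∈ Ioc 0 1 := ⟨inv_pos.2 hR0, inv_le_one_of_one_le₀ hR⟩
  have hlogR : Real.log R = 1 + Real.log K + s * Real.log (n + 1 : ℕ) := by
    rw [Real.log_mul (by positivity) (by positivity), Real.log_mul (by positivity) (by positivity),
      Real.log_exp, Real.log_rpow (by positivity)]
  have hosc : ∀ f : ℝ → ℝ, ‖oscInt f lam R⁻¹ 1‖ ≤ Real.log R := fun f => by
    simpa using norm_oscInt_le_log f lam hR_inv.1 hR_inv.2
  have hremainder :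
      2 * (K ^ (n + 2) * ((n + 1)! : ℝ) ^ s) * (|lam| * R⁻¹ ^ (n + 1)) ≤ 2 * K :=
    calc 2 * (K ^ (n + 2) * ((n + 1)! : ℝ) ^ s) * (|lam| * R⁻¹ ^ (n + 1))
        ≤ 2 * (K ^ (n + 2) * (((n + 1 : ℕ) : ℝ) ^ s) ^ (n + 1)) *
            (Real.exp 1 ^ (n + 1) * R⁻¹ ^ (n + 1)) := by
          gcongr
          exact factorial_rpow_le hs (n + 1)
      _ = 2 * K * (R * R⁻¹) ^ (n + 1) := by ring
      _ = 2 * K := by rw [mul_inv_cancel₀ hR0.ne', one_pow, mul_one]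
  linarith [norm_m_le_of_iteratedDeriv_eq_zero hψ h0 hbound hR_inv lam, hosc ψ,
    hosc fun t => ψ (-t)]

lemma tendsto_log_log : Tendsto (fun lam : ℝ => Real.log (Real.log lam)) atTop atTop :=
  Real.tendsto_log_atTop.comp Real.tendsto_log_atTop

lemma isBigO_log_log {F : ℝ → ℂ} {C D : ℝ}
    (h : ∀ᶠ lam in atTop, ‖F lam‖ ≤ C + D * Real.log (Real.log lam)) :
    F =O[atTop] fun lam : ℝ => Real.log (Real.log lam) := by
  refine IsBigO.of_bound (|C| + D) ?_
  filter_upwards [h, tendsto_log_log.eventually_ge_atTop 1] with lam hF hlog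
  have hC : C ≤ |C| * Real.log (Real.log lam) :=
    (le_abs_self C).trans (le_mul_of_one_le_right (abs_nonneg C) hlog)
  rw [Real.norm_of_nonneg (zero_le_one.trans hlog), add_mul]
  exact hF.trans (by gcongr)

lemma Gevrey.isBigO_m_of_flat (hψ : Gevrey s ψ) (hs : 0 ≤ s)
    (h0 : ∀ j, iteratedDeriv (j + 1) ψ 0 = 0) :
    m ψ =O[atTop] fun lam : ℝ => Real.log (Real.log lam) := by
  obtain ⟨hsmooth, K₀, hK₀, hbound⟩ := hψ
  set K := max K₀ 1
  refine isBigO_log_log (C := 2 * K + 2 * (1 + Real.log K + s * Real.log 2)) (D := 2 * s) ?_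
  filter_upwards [eventually_ge_atTop (Real.exp 1)] with lam hlam
  have hlam0 : 0 < lam := (Real.exp_pos 1).trans_le hlam
  have hlog : 1 ≤ Real.log lam := by rwa [Real.le_log_iff_exp_le hlam0]
  obtain ⟨n, hn⟩ : ∃ n : ℕ, ⌈Real.log lam⌉₊ = n + 1 :=
    Nat.exists_eq_succ_of_ne_zero (Nat.ceil_pos.2 (by linarith)).ne'
  have hlam_le : |lam| ≤ Real.exp 1 ^ (n + 1) := by
    rw [abs_of_pos hlam0, ← Real.exp_nat_mul, mul_one, ← Real.log_le_iff_le_exp hlam0, ← hn]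
    exact Nat.le_ceil _
  have hn_le : ((n + 1 : ℕ) : ℝ) ≤ 2 * Real.log lam := by
    rw [← hn]
    linarith [Nat.ceil_lt_add_one (zero_le_one.trans hlog)]
  have hlog_n : Real.log (n + 1 : ℕ) ≤ Real.log 2 + Real.log (Real.log lam) := by
    rw [← Real.log_mul two_ne_zero (by positivity)]
    exact Real.log_le_log (by positivity) hn_le
  have hm := norm_m_le_log_of_iteratedDeriv_eq_zero hsmooth hs (le_max_right K₀ 1) (fun j _ => h0 j)
    (fun t ht => (hbound (n + 1) t ht).trans (by gcongr; exact le_max_left K₀ 1)) hlam_le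
  linarith [mul_le_mul_of_nonneg_left hlog_n hs]

lemma Gevrey.isBigO_m (hψ : Gevrey s ψ) :
    m ψ =O[atTop] fun lam : ℝ => Real.log (Real.log lam) := by
  by_cases hfin : ∃ n, iteratedDeriv (n + 1) ψ 0 ≠ 0
  · obtain ⟨C, hC⟩ := exists_norm_m_le_of_finite_type hψ.1 hfin
    refine isBigO_log_log (C := C) (D := 0) ?_
    filter_upwards [eventually_ge_atTop 1] with lam hlam
    simpa using hC lam hlam
  · push Not at hfin
    exact (hψ.mono (le_max_left s 0)).isBigO_m_of_flat (le_max_right s 0) hfin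

end FlatPhase

section FlatPhaseGevrey

/-- The holomorphic extension `z ↦ exp (-z ^ (-a))` of the flat phase to the slit plane, to which
Cauchy's estimates apply. -/
noncomputable def flatExt (a : ℝ) (z : ℂ) : ℂ := Complex.exp (-(z ^ (-(a : ℂ))))

/-- The `n`-th derivative of the flat phase with exponent `a = 1 / (s - 1)`, read off the
holomorphic extension `flatExt` on `t > 0` and set to `0` on `t ≤ 0`. -/
noncomputable def flatDeriv (a : ℝ) (n : ℕ) (t : ℝ) : ℝ :=
  if 0 < t then (iteratedDeriv n (flatExt a) t).re else 0

variable {a t : ℝ} {z : ℂ}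

lemma flatDeriv_of_nonpos (a : ℝ) (n : ℕ) (ht : t ≤ 0) : flatDeriv a n t = 0 :=
  if_neg ht.not_gt

lemma flatPhase_eq_flatDeriv (s : ℝ) : flatPhase s = flatDeriv (1 / (s - 1)) 0 := by
  ext t
  rw [flatPhase, flatDeriv]
  split_ifs with ht
  · rw [iteratedDeriv_zero, flatExt, ← Complex.ofReal_neg, ← Complex.ofReal_cpow ht.le,
      ← Complex.ofReal_neg, ← Complex.ofReal_exp, Complex.ofReal_re]
  · rfl

lemma differentiableAt_flatExt (a : ℝ) (hz : z ∈ Complex.slitPlane) :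
    DifferentiableAt ℂ (flatExt a) z :=
  ((differentiableAt_id.cpow_const hz).neg).cexp

lemma hasDerivAt_iteratedDeriv_flatExt (a : ℝ) (n : ℕ) (hz : z ∈ Complex.slitPlane) :
    HasDerivAt (iteratedDeriv n (flatExt a)) (iteratedDeriv (n + 1) (flatExt a) z) z := by
  have hanalytic : AnalyticAt ℂ (flatExt a) z :=
    DifferentiableOn.analyticAt
      (fun _ hw => (differentiableAt_flatExt a hw).differentiableWithinAt)
      (Complex.isOpen_slitPlane.mem_nhds hz)
  rw [iteratedDeriv_succ, iteratedDeriv_eq_iterate]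
  exact (hanalytic.iterated_deriv n).differentiableAt.hasDerivAt

lemma exists_half_le_re_cpow (p : ℂ) :
    ∃ c : ℝ, 0 < c ∧ c < 1 ∧ ∀ w : ℂ, ‖w - 1‖ ≤ c → 1 / 2 ≤ (w ^ p).re := by
  have hcont : ContinuousAt (fun w : ℂ => (w ^ p).re) 1 :=
    Complex.continuous_re.continuousAt.comp
      (continuousAt_id.cpow continuousAt_const Complex.one_mem_slitPlane)
  have hnear : ∀ᶠ w in 𝓝 (1 : ℂ), 1 / 2 < (w ^ p).re :=
    hcont.eventually (lt_mem_nhds (by norm_num [Complex.one_cpow]))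
  obtain ⟨r, hr, hball⟩ := Metric.eventually_nhds_iff.1 hnear
  refine ⟨min (r / 2) (1 / 2), by positivity, (min_le_right _ _).trans_lt (by norm_num),
    fun w hw => (hball ?_).le⟩
  rw [dist_eq_norm]
  exact (hw.trans (min_le_left _ _)).trans_lt (half_lt_self hr)

lemma ofReal_mul_cpow {w : ℂ} (ht : 0 < t) (hw : w ≠ 0) (p : ℂ) :
    (t * w) ^ p = (t : ℂ) ^ p * w ^ p := by
  have ht' : (t : ℂ) ≠ 0 := Complex.ofReal_ne_zero.2 ht.ne'
  rw [Complex.cpow_def_of_ne_zero (mul_ne_zero ht' hw), Complex.cpow_def_of_ne_zero ht',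
    Complex.cpow_def_of_ne_zero hw, Complex.log_ofReal_mul ht hw, add_mul, Complex.exp_add,
    Complex.ofReal_log ht.le]

lemma norm_flatExt_le {c : ℝ} (ht : 0 < t) (hc1 : c < 1)
    (hc : ∀ w : ℂ, ‖w - 1‖ ≤ c → 1 / 2 ≤ (w ^ (-(a : ℂ))).re) (hz : ‖z - t‖ ≤ c * t) :
    ‖flatExt a z‖ ≤ Real.exp (-(t ^ (-a) / 2)) := by
  have ht' : (t : ℂ) ≠ 0 := Complex.ofReal_ne_zero.2 ht.ne'
  obtain ⟨w, rfl⟩ : ∃ w : ℂ, z = t * w := ⟨z / t, (mul_div_cancel₀ z ht').symm⟩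
  have hw1 : ‖w - 1‖ ≤ c := by
    rw [← mul_sub_one, norm_mul, Complex.norm_real, Real.norm_of_nonneg ht.le, mul_comm] at hz
    exact le_of_mul_le_mul_right hz ht
  have hw0 : w ≠ 0 := by
    rintro rfl
    rw [zero_sub, norm_neg, norm_one] at hw1
    exact hc1.not_ge hw1
  have hpow : (t : ℂ) ^ (-(a : ℂ)) = (t ^ (-a) : ℝ) := by
    rw [Complex.ofReal_cpow ht.le, Complex.ofReal_neg]
  rw [flatExt, Complex.norm_exp, ofReal_mul_cpow ht hw0, hpow, Complex.neg_re,
    Complex.re_ofReal_mul, Real.exp_le_exp]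
  linarith [mul_le_mul_of_nonneg_left (hc w hw1) (Real.rpow_pos_of_pos ht (-a)).le]

lemma closedBall_subset_slitPlane {c : ℝ} (ht : 0 < t) (hc1 : c < 1) :
    Metric.closedBall (t : ℂ) (c * t) ⊆ Complex.slitPlane := by
  intro z hz
  rw [Metric.mem_closedBall, dist_eq_norm] at hz
  have hre := (abs_le.1 ((Complex.abs_re_le_norm _).trans hz)).1
  rw [Complex.sub_re, Complex.ofReal_re] at hre
  exact Or.inl (by nlinarith)

lemma norm_iteratedDeriv_flatExt_le {c : ℝ} (ht : 0 < t) (hc0 : 0 < c) (hc1 : c < 1)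
    (hc : ∀ w : ℂ, ‖w - 1‖ ≤ c → 1 / 2 ≤ (w ^ (-(a : ℂ))).re) (n : ℕ) :
    ‖iteratedDeriv n (flatExt a) t‖ ≤ n ! * Real.exp (-(t ^ (-a) / 2)) / (c * t) ^ n := by
  have hct : 0 < c * t := mul_pos hc0 ht
  have hdiff : DiffContOnCl ℂ (flatExt a) (Metric.ball (t : ℂ) (c * t)) := by
    apply DifferentiableOn.diffContOnCl
    rw [closure_ball _ hct.ne']
    exact fun z hz => (differentiableAt_flatExt a
      (closedBall_subset_slitPlane ht hc1 hz)).differentiableWithinAt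
  exact Complex.norm_iteratedDeriv_le_of_forall_mem_sphere_norm_le n hct hdiff
    fun z hz => norm_flatExt_le ht hc1 hc (mem_sphere_iff_norm.1 hz).le

lemma inv_pow_mul_exp_le (ha : 0 < a) (ht : 0 < t) (n : ℕ) :
    (t ^ n)⁻¹ * Real.exp (-(t ^ (-a) / 2)) ≤ ((2 / a) ^ n * n !) ^ a⁻¹ := by
  set v := t ^ (-a) with hv
  have hv0 : 0 < v := Real.rpow_pos_of_pos ht _
  have hpow : ((t ^ n)⁻¹) ^ a = v ^ n := by
    rw [Real.inv_rpow (pow_nonneg ht.le n), ← Real.rpow_pow_comm ht.le, hv, Real.rpow_neg ht.le,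
      inv_pow]
  have hexp : (a / 2 * v) ^ n / n ! ≤ Real.exp (a / 2 * v) :=
    Real.pow_div_factorial_le_exp _ (by positivity) n
  rw [Real.le_rpow_inv_iff_of_pos (by positivity) (by positivity) ha,
    Real.mul_rpow (by positivity) (by positivity), hpow, ← Real.exp_mul]
  calc v ^ n * Real.exp (-(v / 2) * a)
      = (2 / a) ^ n * n ! * ((a / 2 * v) ^ n / n ! * Real.exp (-(v / 2) * a)) := by
        have hcancel : (2 / a) ^ n * (a / 2 * v) ^ n = v ^ n := by
          rw [← mul_pow]
          field_simp
        rw [← hcancel]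
        field_simp
    _ ≤ (2 / a) ^ n * n ! * (Real.exp (a / 2 * v) * Real.exp (-(v / 2) * a)) := by gcongr
    _ = (2 / a) ^ n * n ! := by
        rw [← Real.exp_add]
        ring_nf
        simp

lemma exists_abs_flatDeriv_le (ha : 0 < a) : ∃ c : ℝ, 0 < c ∧ ∀ (n k : ℕ) (t : ℝ),
    |flatDeriv a n t| ≤ n ! * c ^ n * ((2 / a) ^ (n + k) * (n + k)!) ^ a⁻¹ * |t| ^ k := by
  obtain ⟨c, hc0, hc1, hc⟩ := exists_half_le_re_cpow (-(a : ℂ))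
  refine ⟨c⁻¹, inv_pos.2 hc0, fun n k t => ?_⟩
  rcases le_or_gt t 0 with ht | ht
  · rw [flatDeriv_of_nonpos a n ht, abs_zero]
    positivity
  rw [flatDeriv, if_pos ht, abs_of_pos ht]
  calc |(iteratedDeriv n (flatExt a) t).re|
      ≤ n ! * Real.exp (-(t ^ (-a) / 2)) / (c * t) ^ n :=
        (Complex.abs_re_le_norm _).trans (norm_iteratedDeriv_flatExt_le ht hc0 hc1 hc n)
    _ = n ! * c⁻¹ ^ n * ((t ^ (n + k))⁻¹ * Real.exp (-(t ^ (-a) / 2))) * t ^ k := by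
        rw [mul_pow, pow_add, inv_pow]
        field_simp
    _ ≤ n ! * c⁻¹ ^ n * ((2 / a) ^ (n + k) * (n + k)!) ^ a⁻¹ * t ^ k := by
        gcongr
        exact inv_pow_mul_exp_le ha ht (n + k)

lemma hasDerivAt_flatDeriv_zero (ha : 0 < a) (n : ℕ) : HasDerivAt (flatDeriv a n) 0 0 := by
  obtain ⟨c, -, hbound⟩ := exists_abs_flatDeriv_le ha
  rw [hasDerivAt_iff_isLittleO]
  simp only [flatDeriv_of_nonpos a n le_rfl, sub_zero, smul_zero]
  have hsq : flatDeriv a n =O[𝓝 0] fun t => t ^ 2 :=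
    IsBigO.of_bound _ (Eventually.of_forall fun t => by
      simpa only [norm_pow, Real.norm_eq_abs] using hbound n 2 t)
  exact hsq.trans_isLittleO (isLittleO_pow_id one_lt_two)

lemma hasDerivAt_flatDeriv (ha : 0 < a) (n : ℕ) (t : ℝ) :
    HasDerivAt (flatDeriv a n) (flatDeriv a (n + 1) t) t := by
  rcases lt_trichotomy t 0 with ht | rfl | ht
  · rw [flatDeriv_of_nonpos a (n + 1) ht.le]
    refine (hasDerivAt_const t (0 : ℝ)).congr_of_eventuallyEq ?_
    filter_upwards [Iio_mem_nhds ht] with x hx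
    exact flatDeriv_of_nonpos a n hx.le
  · rw [flatDeriv_of_nonpos a (n + 1) le_rfl]
    exact hasDerivAt_flatDeriv_zero ha n
  · rw [flatDeriv, if_pos ht]
    refine (hasDerivAt_iteratedDeriv_flatExt a n
      (Complex.ofReal_mem_slitPlane.2 ht)).real_of_complex.congr_of_eventuallyEq ?_
    filter_upwards [Ioi_mem_nhds ht] with x hx
    exact if_pos hx

section DerivativeSequence

variable {𝕜 F : Type*} [NontriviallyNormedField 𝕜] [NormedAddCommGroup F] [NormedSpace 𝕜 F]
  {g : ℕ → 𝕜 → F}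

lemma iteratedDeriv_eq_of_hasDerivAt (hg : ∀ n x, HasDerivAt (g n) (g (n + 1) x) x) (n : ℕ) :
    iteratedDeriv n (g 0) = g n := by
  induction n with
  | zero => exact iteratedDeriv_zero
  | succ n ih => rw [iteratedDeriv_succ, ih]; exact funext fun x => (hg n x).deriv

lemma contDiff_of_hasDerivAt (hg : ∀ n x, HasDerivAt (g n) (g (n + 1) x) x) :
    ContDiff 𝕜 ∞ (g 0) := by
  refine contDiff_of_differentiable_iteratedDeriv fun n _ => ?_
  rw [iteratedDeriv_eq_of_hasDerivAt hg]
  exact fun x => (hg n x).differentiableAt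

end DerivativeSequence

lemma gevrey_flatDeriv (ha : 0 < a) : Gevrey (1 + a⁻¹) (flatDeriv a 0) := by
  have hsmooth : ContDiff ℝ ∞ (flatDeriv a 0) := contDiff_of_hasDerivAt (hasDerivAt_flatDeriv ha)
  obtain ⟨c, hc, hbound⟩ := exists_abs_flatDeriv_le ha
  set K := max (c * (2 / a) ^ a⁻¹) 1
  refine ⟨hsmooth.contDiffOn, K, by positivity, fun n t ht => ?_⟩
  rw [iteratedDerivWithin_eq_iteratedDeriv (uniqueDiffOn_Icc (by norm_num))
    (hsmooth.of_le (mod_cast le_top)).contDiffAt ht,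
    iteratedDeriv_eq_of_hasDerivAt (hasDerivAt_flatDeriv ha)]
  calc |flatDeriv a n t|
      ≤ n ! * c ^ n * ((2 / a) ^ n * n !) ^ a⁻¹ := by simpa using hbound n 0 t
    _ = (c * (2 / a) ^ a⁻¹) ^ n * (n ! : ℝ) ^ (1 + a⁻¹) := by
        rw [Real.mul_rpow (by positivity) (by positivity), ← Real.rpow_pow_comm (by positivity),
          Real.rpow_one_add' (by positivity) (by positivity), mul_pow]
        ring
    _ ≤ K ^ n * (n ! : ℝ) ^ (1 + a⁻¹) := by gcongr; exact le_max_left _ _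
    _ ≤ K ^ (n + 1) * (n ! : ℝ) ^ (1 + a⁻¹) := by
        gcongr
        · exact le_max_right _ _
        · exact n.le_succ

lemma gevrey_flatPhase {s : ℝ} (hs : 1 < s) : Gevrey s (flatPhase s) := by
  have h := gevrey_flatDeriv (one_div_pos.2 (sub_pos.2 hs))
  rwa [one_div, inv_inv, add_sub_cancel, ← one_div, ← flatPhase_eq_flatDeriv] at h

end FlatPhaseGevrey

section Sharpness

variable {ψ : ℝ → ℝ} {a s t δ ε lam : ℝ}

lemma oscInt_zero (lam : ℝ) (hε : 0 < ε) :
    oscInt (fun _ => 0) lam ε 1 = (Real.log (1 / ε) : ℂ) := by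
  rw [← integral_one_div_of_pos hε one_pos, oscInt, ← intervalIntegral.integral_ofReal]
  simp

lemma log_sub_norm_oscInt_le_norm_truncated (hψ : ContinuousOn ψ (Icc (-1) 1))
    (hneg : ∀ t < 0, ψ t = 0) (lam : ℝ) (hε : 0 < ε) (hεδ : ε ≤ δ) (hδ : δ ≤ 1) :
    Real.log (1 / δ) - ‖oscInt ψ lam δ 1‖ ≤ ‖truncated ψ lam ε‖ := by
  have hδ0 : 0 < δ := hε.trans_le hεδ
  have hnegative : oscInt (fun t => ψ (-t)) lam ε 1 = (Real.log (1 / ε) : ℂ) := by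
    rw [← oscInt_zero lam hε]
    refine intervalIntegral.integral_congr fun t ht => ?_
    rw [uIcc_of_le (hεδ.trans hδ)] at ht
    simp only [hneg (-t) (neg_lt_zero.2 (hε.trans_le ht.1))]
  have hlower : Real.log (1 / ε) ≤ ‖oscInt ψ lam ε 1‖ + ‖truncated ψ lam ε‖ :=
    calc Real.log (1 / ε) ≤ ‖(Real.log (1 / ε) : ℂ)‖ := by
          rw [Complex.norm_real]
          exact Real.le_norm_self _
      _ = ‖oscInt ψ lam ε 1 - truncated ψ lam ε‖ := by
          rw [truncated_eq, hnegative, sub_sub_cancel]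
      _ ≤ ‖oscInt ψ lam ε 1‖ + ‖truncated ψ lam ε‖ := norm_sub_le _ _
  have hupper : ‖oscInt ψ lam ε 1‖ ≤ Real.log (δ / ε) + ‖oscInt ψ lam δ 1‖ := by
    rw [← oscInt_add (hψ.mono (Icc_one_subset hε)) hε hεδ hδ]
    exact norm_add_le_of_le (norm_oscInt_le_log ψ lam hε hεδ) le_rfl
  have hlog : Real.log (1 / ε) = Real.log (1 / δ) + Real.log (δ / ε) := by
    rw [← Real.log_mul (by positivity) (by positivity), one_div_mul_eq_div,
      div_div_cancel_left' hδ0.ne', one_div]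
  linarith

lemma hasDerivAt_exp_neg_rpow (a : ℝ) (ht : 0 < t) :
    HasDerivAt (fun t : ℝ => Real.exp (-(t ^ (-a))))
      (a * t ^ (-a) * Real.exp (-(t ^ (-a))) / t) t := by
  refine (Real.hasDerivAt_rpow_const (p := -a) (Or.inl ht.ne')).fun_neg.exp.congr_deriv ?_
  rw [Real.rpow_sub_one ht.ne']
  ring

lemma norm_oscInt_exp_neg_rpow_le (ha : 0 < a) (hlam : 0 < lam) (hδ : δ ∈ Ioc 0 1) :
    ‖oscInt (fun t => Real.exp (-(t ^ (-a)))) lam δ 1‖ ≤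
      2 / (lam * (a * δ ^ (-a) * Real.exp (-(δ ^ (-a))))) := by
  have hpos : ∀ t ∈ Icc δ 1, 0 < t := fun t ht => hδ.1.trans_le ht.1
  refine norm_oscInt_le_of_deriv hlam hδ.1 hδ.2
    (h := fun t => a * t ^ (-a) * Real.exp (-(t ^ (-a))))
    (h' := fun t => a ^ 2 * t ^ (-a) / t * Real.exp (-(t ^ (-a))) * (t ^ (-a) - 1))
    (fun t ht => hasDerivAt_exp_neg_rpow a (hpos t ht)) (fun t ht => ?_) (fun t ht => ?_)
    fun t ht => ?_
  · have ht0 := hpos t ht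
    refine (((Real.hasDerivAt_rpow_const (p := -a) (Or.inl ht0.ne')).const_mul a).fun_mul
      (hasDerivAt_exp_neg_rpow a ht0)).congr_deriv ?_
    rw [Real.rpow_sub_one ht0.ne']
    ring
  · have ht0 := hpos t ht
    positivity
  · have ht0 := hpos t ht
    have hone_le : 1 ≤ t ^ (-a) :=
      Real.one_le_rpow_of_pos_of_le_one_of_nonpos ht0 ht.2 (neg_nonpos.2 ha.le)
    exact mul_nonneg (by positivity) (sub_nonneg.2 hone_le)

lemma oscInt_flatPhase (s lam : ℝ) (hδ : δ ∈ Ioc 0 1) :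
    oscInt (flatPhase s) lam δ 1 =
      oscInt (fun t => Real.exp (-(t ^ (-(1 / (s - 1)))))) lam δ 1 := by
  refine intervalIntegral.integral_congr fun t ht => ?_
  rw [uIcc_of_le hδ.2] at ht
  simp only [flatPhase, if_pos (hδ.1.trans_le ht.1)]

-- At `δ = (log lam) ^ (-(s - 1))` the phase `lam * flatPhase s δ` equals `1`, so oscillation sets
-- in just to the right of `δ`.
lemma le_norm_m_flatPhase (hs : 1 < s) (hlam : Real.exp 1 ≤ lam) :
    (s - 1) * (Real.log (Real.log lam) - 2) ≤ ‖m (flatPhase s) lam‖ := by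
  have hs0 : 0 < s - 1 := sub_pos.2 hs
  have hlam0 : 0 < lam := (Real.exp_pos 1).trans_le hlam
  have hlog : 1 ≤ Real.log lam := by rwa [Real.le_log_iff_exp_le hlam0]
  have hlog0 : 0 < Real.log lam := one_pos.trans_le hlog
  set δ := Real.log lam ^ (-(s - 1)) with hδ_def
  have hδ : δ ∈ Ioc 0 1 := ⟨Real.rpow_pos_of_pos hlog0 _,
    Real.rpow_le_one_of_one_le_of_nonpos hlog (neg_nonpos.2 hs0.le)⟩
  have hosc : ‖oscInt (flatPhase s) lam δ 1‖ ≤ 2 * (s - 1) := by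
    have hδ_rpow : δ ^ (-(1 / (s - 1))) = Real.log lam := by
      rw [hδ_def, ← Real.rpow_mul hlog0.le, neg_mul_neg, mul_one_div_cancel hs0.ne', Real.rpow_one]
    rw [oscInt_flatPhase s lam hδ]
    calc _ ≤ 2 / (lam * (1 / (s - 1) * Real.log lam * Real.exp (-Real.log lam))) := by
          simpa only [hδ_rpow] using
            norm_oscInt_exp_neg_rpow_le (one_div_pos.2 hs0) hlam0 hδ
      _ = 2 * (s - 1) / Real.log lam := by
          rw [Real.exp_neg, Real.exp_log hlam0]
          field_simp
      _ ≤ 2 * (s - 1) := div_le_self (by positivity) hlog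
  have hlog_δ : Real.log (1 / δ) = (s - 1) * Real.log (Real.log lam) := by
    rw [one_div, Real.log_inv, hδ_def, Real.log_rpow hlog0, neg_mul, neg_neg]
  obtain ⟨K, hlip⟩ := exists_lipschitzOnWith (gevrey_flatPhase hs).1
  refine ge_of_tendsto (tendsto_truncated hlip lam).norm ?_
  filter_upwards [Ioc_mem_nhdsGT hδ.1] with ε hε
  linarith [log_sub_norm_oscInt_le_norm_truncated hlip.continuousOn
    (fun t ht => if_neg ht.not_gt) lam hε.1 hε.2 hδ.2]

lemma isBigO_log_log_m_flatPhase (hs : 1 < s) :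
    (fun lam : ℝ => Real.log (Real.log lam)) =O[atTop] m (flatPhase s) := by
  have hs0 : 0 < s - 1 := sub_pos.2 hs
  refine IsBigO.of_bound (2 / (s - 1)) ?_
  filter_upwards [eventually_ge_atTop (Real.exp 1), tendsto_log_log.eventually_ge_atTop 4]
    with lam hlam hlog
  rw [Real.norm_of_nonneg (by linarith), div_mul_eq_mul_div, le_div_iff₀ hs0]
  nlinarith [le_norm_m_flatPhase hs hlam]

end Sharpness

end SteinWainger

theorem theorem1p3_general (s : ℝ) :
    (∀ ψ : ℝ → ℝ, SteinWainger.Gevrey s ψ →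
      (∀ lam : ℝ, Filter.Tendsto (SteinWainger.truncated ψ lam)
        (nhdsWithin (0 : ℝ) (Set.Ioi 0)) (nhds (SteinWainger.m ψ lam))) ∧
      Asymptotics.IsBigO Filter.atTop (SteinWainger.m ψ)
        (fun lam : ℝ => Real.log (Real.log lam))) ∧
    (1 < s → SteinWainger.Gevrey s (SteinWainger.flatPhase s) ∧
      Asymptotics.IsTheta Filter.atTop (SteinWainger.m (SteinWainger.flatPhase s))
        (fun lam : ℝ => Real.log (Real.log lam))) := by
  refine ⟨fun ψ hψ => ⟨?_, hψ.isBigO_m⟩, fun hs => ?_⟩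
  · obtain ⟨K, hlip⟩ := SteinWainger.exists_lipschitzOnWith hψ.1
    exact SteinWainger.tendsto_truncated hlip
  · have hflat := SteinWainger.gevrey_flatPhase hs
    exact ⟨hflat, hflat.isBigO_m, SteinWainger.isBigO_log_log_m_flatPhase hs⟩

theorem theorem1p3 (s : ℝ) (hs : 1 < s) :
    (∀ ψ : ℝ → ℝ, SteinWainger.Gevrey s ψ →
      (∀ lam : ℝ, Filter.Tendsto (SteinWainger.truncated ψ lam)
        (nhdsWithin (0 : ℝ) (Set.Ioi 0)) (nhds (SteinWainger.m ψ lam))) ∧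
      Asymptotics.IsBigO Filter.atTop (SteinWainger.m ψ)
        (fun lam : ℝ => Real.log (Real.log lam))) ∧
    (SteinWainger.Gevrey s (SteinWainger.flatPhase s) ∧
      Asymptotics.IsTheta Filter.atTop
        (fun n : ℕ => SteinWainger.m (SteinWainger.flatPhase s) (2 * Real.pi * (n : ℝ)))
        (fun n : ℕ => Real.log (Real.log (2 * Real.pi * (n : ℝ))))) := by
  obtain ⟨hbound, hsharp⟩ := theorem1p3_general s
  have htend : Filter.Tendsto (fun n : ℕ => 2 * Real.pi * (n : ℝ)) Filter.atTop Filter.atTop :=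
    tendsto_natCast_atTop_atTop.const_mul_atTop (by positivity)
  obtain ⟨hflat, hupper, hlower⟩ := hsharp hs
  exact ⟨hbound, hflat, hupper.comp_tendsto htend, hlower.comp_tendsto htend⟩
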